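/- **Proposition.** Let $f:\mathbb R^d\to\mathbb R$ be differentiable and suppose that there are constants $G,L$ with $$\|\nabla f(x)\|\le G,\qquad \|\nabla f(y)-\nabla f(x)\|\le L\|y-x\|\qquad\text{for all }x,y\in\mathbb R^d .$$ Let $(S,\mathcal S,P)$ be a probability space and let $Z:\mathbb R^d\times S\to\mathbb R^d$ be a (jointly measurable) noise term such that, for some $q\in[2,\infty)$ and $\sigma\ge 0$, $$\int_S Z(x;s)\,dP(s)=0\quad\text{and}\quad \int_S\|Z(x;s)\|^q\,dP(s)\le\sigma^q\qquad\text{for all }x\in\mathbb R^d .$$ Let $(\gamma_n)_{n\ge1}$ be positive step sizes with $\sum_{n}\gamma_n=\infty$ and $\sum_n\gamma_n^{1+q/2}<\infty$, and let $(X_n)_{n\ge1}$ be the iterates of stochastic gradient descent, $$X_{n+1}=X_n-\gamma_n\bigl(\nabla f(X_n)+Z(X_n;s_n)\bigr),\qquad n\ge1,$$ where $X_1$ is an arbitrary random vector in $\mathbb R^d$ and each seed $s_n$ is a random element of $S$ with law $P$ that is independent of $\sigma(X_1,\dots,X_n)$. Put $\tau_n=\sum_{k=1}^n\gamma_k$ and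 let $X(t)$, $t\ge\tau_1$, be the affine interpolation $$X(t)=X_n+\frac{t-\tau_n}{\tau_{n+1}-\tau_n}\,(X_{n+1}-X_n)\qquad\text{for }t\in[\tau_n,\tau_{n+1}] .$$ Then the gradient flow $\dot x=-\nabla f(x)$ has a solution on $[0,\infty)$ from every initial point and, if $\Phi_h(x)$ denotes the point reached at time $h\ge0$ by the solution that starts at $x$, then, with probability $1$, $X(\cdot)$ is an asymptotic pseudotrajectory of the gradient flow, that is, $$\lim_{t\to\infty}\ \sup_{0\le h\le T}\bigl\|X(t+h)-\Phi_h(X(t))\bigr\|=0\qquad\text{for every }T>0 .$$ -/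

import Mathlib

open MeasureTheory ProbabilityTheory Filter Topology Set
open scoped ENNReal

namespace SGD

/-- `d`-dimensional Euclidean space. -/
abbrev Pt (d : ℕ) : Type := EuclideanSpace ℝ (Fin d)

/-- `f` is differentiable, `G`-Lipschitz and `L`-smooth (its gradient is bounded by `G` and
`L`-Lipschitz). -/
structure LipschitzSmooth {d : ℕ} (f : Pt d → ℝ) (G L : ℝ) : Prop where
  differentiable : Differentiable ℝ f
  norm_gradient_le : ∀ x, ‖gradient f x‖ ≤ G
  norm_gradient_sub_le : ∀ x y, ‖gradient f y - gradient f x‖ ≤ L * ‖y - x‖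

/-- The error term `Z(x; s)` of a stochastic first-order oracle
`V(x; s) = ∇f(x) + Z(x; s)`, with `s` drawn from the probability space `(S, P)`: at every query
point it has zero mean and a `q`-th moment bounded by `σ ^ q`. (The moment is a `ℝ≥0∞`-valued
integral, so the bound contains the integrability of `Z x`.) -/
structure OracleNoise {d : ℕ} {S : Type*} [MeasurableSpace S] (Z : Pt d → S → Pt d)
    (P : Measure S) (q σ : ℝ) : Prop where
  measurable : Measurable (Function.uncurry Z)
  zero_mean : ∀ x, ∫ s, Z x s ∂P = 0
  moment_le : ∀ x, ∫⁻ s, ‖Z x s‖ₑ ^ q ∂P ≤ ENNReal.ofReal (σ ^ q)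

/-- The iterates of stochastic gradient descent,
`X (n + 1) = X n - γ n • (∇f (X n) + Z (X n) (s n))`, for a given initial point, step-size
sequence `γ` and sequence of seeds `s`. The first iterate has index `0`. -/
noncomputable def iterate {d : ℕ} {S : Type*} (f : Pt d → ℝ) (Z : Pt d → S → Pt d)
    (γ : ℕ → ℝ) (x₀ : Pt d) (s : ℕ → S) : ℕ → Pt d
  | 0 => x₀
  | n + 1 =>
    iterate f Z γ x₀ s n -
      γ n • (gradient f (iterate f Z γ x₀ s n) + Z (iterate f Z γ x₀ s n) (s n))

/-- Elapsed time up to the iteration `n`, inclusive: the sum of `γ k` over `k ≤ n`. -/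
noncomputable def elapsed (γ : ℕ → ℝ) (n : ℕ) : ℝ := ∑ k ∈ Finset.range (n + 1), γ k

/-- The last iteration index `n` with `elapsed γ n ≤ t`. -/
noncomputable def clock (γ : ℕ → ℝ) (t : ℝ) : ℕ := sSup {n : ℕ | elapsed γ n ≤ t}

/-- The affine interpolation of the sequence `x`: the value at `t ∈ [τ n, τ (n + 1)]` is
`x n + ((t - τ n) / (τ (n + 1) - τ n)) • (x (n + 1) - x n)`, where `τ = elapsed γ`
(see `interpolation_eq`). Only times `t ≥ τ 0` are relevant. -/
noncomputable def interpolation {d : ℕ} (γ : ℕ → ℝ) (x : ℕ → Pt d) (t : ℝ) : Pt d :=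
  x (clock γ t) +
    ((t - elapsed γ (clock γ t)) / (elapsed γ (clock γ t + 1) - elapsed γ (clock γ t))) •
      (x (clock γ t + 1) - x (clock γ t))

theorem elapsed_strictMono {γ : ℕ → ℝ} (hγ : ∀ n, 0 < γ n) : StrictMono (elapsed γ) := by
  refine strictMono_nat_of_lt_succ fun n => ?_
  have h := hγ (n + 1)
  unfold elapsed
  rw [Finset.sum_range_succ _ (n + 1)]
  linarith

theorem clock_eq {γ : ℕ → ℝ} (hγ : ∀ n, 0 < γ n) {n : ℕ} {t : ℝ}
    (h₁ : elapsed γ n ≤ t) (h₂ : t < elapsed γ (n + 1)) : clock γ t = n := by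
  refine IsGreatest.csSup_eq ⟨h₁, fun m hm => ?_⟩
  have h : elapsed γ m < elapsed γ (n + 1) := lt_of_le_of_lt hm h₂
  exact Nat.lt_succ_iff.mp ((elapsed_strictMono hγ).lt_iff_lt.mp h)

theorem interpolation_eq {d : ℕ} {γ : ℕ → ℝ} (hγ : ∀ n, 0 < γ n) (x : ℕ → Pt d) (n : ℕ) {t : ℝ}
    (ht : t ∈ Icc (elapsed γ n) (elapsed γ (n + 1))) :
    interpolation γ x t =
      x n + ((t - elapsed γ n) / (elapsed γ (n + 1) - elapsed γ n)) • (x (n + 1) - x n) := by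
  rcases lt_or_eq_of_le ht.2 with h | h
  · rw [interpolation, clock_eq hγ ht.1 h]
  · have hm := elapsed_strictMono hγ
    have hc : clock γ t = n + 1 := clock_eq hγ h.ge (h ▸ hm (Nat.lt_succ_self _))
    have hne : elapsed γ (n + 1) - elapsed γ n ≠ 0 :=
      sub_ne_zero.mpr (hm (Nat.lt_succ_self n)).ne'
    rw [interpolation, hc, h, sub_self, zero_div, zero_smul, add_zero, div_self hne, one_smul]
    abel

/-- `Φ t x`, for `t ≥ 0`, is the position at time `t` of the solution of the gradient flow
`y' = -∇f(y)` that starts at `x`. -/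
structure IsGradientFlow {d : ℕ} (f : Pt d → ℝ) (Φ : ℝ → Pt d → Pt d) : Prop where
  map_zero : ∀ x, Φ 0 x = x
  hasDeriv : ∀ x, ∀ t ∈ Ici (0 : ℝ),
    HasDerivWithinAt (fun r => Φ r x) (-gradient f (Φ t x)) (Ici 0) t

/-- `y` is an asymptotic pseudotrajectory of the semiflow `Φ`: for every `T > 0`, the supremum of
`‖y (t + h) - Φ h (y t)‖` over `0 ≤ h ≤ T` tends to `0` as `t → ∞`. -/
def IsAPT {d : ℕ} (Φ : ℝ → Pt d → Pt d) (y : ℝ → Pt d) : Prop :=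
  ∀ T : ℝ, 0 < T →
    Tendsto (fun t : ℝ => ⨆ h ∈ Icc (0 : ℝ) T, ‖y (t + h) - Φ h (y t)‖ₑ) atTop (𝓝 0)

end SGD

/-! The noise is absorbed into a running average. Let b bound the step sizes, N_0 = 0 and N_{n+1} =
(1 - γ_n/b) N_n + γ_n Z_n, where Z_n = Z(X_n; s_n). In w_n = X_n + N_n the noise cancels: w_{n+1} =
w_n - γ_n (∇f(w_n) + r_n) with r_n = N_n/b - (∇f(w_n) - ∇f(X_n)). As ∇f is Lipschitz, r_n → 0 and
X_n - w_n → 0 as soon as N_n → 0.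

That N_n → 0 almost surely is `ae_tendsto_runningAverage`. By `exists_norm_average_rpow_le`, a step
with weight γ contracts ‖N‖^q by the factor 1 - γ/2, up to a term of zero conditional mean and an
error of order γ^{1+q/2}, summable in expectation. Supermartingale convergence then makes ‖N_n‖^q +
∑_{k<n} (γ_k/2) ‖N_k‖^q converge, and the divergence of ∑ γ_k forces ‖N_n‖^q → 0.

The rest is deterministic: the interpolation of w solves the flow equation up to a vanishing error,
and Grönwall's inequality on windows of length T concludes (`isAPT_of_approx_solution`,
`isAPT_interpolation`). The flow exists because ∇f is bounded and Lipschitz. -/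

namespace SGD

/-! ### Inequalities for powers of the norm. -/

section Inequalities

/-- For v > 0 and a natural number n ≥ s, v ^ s lies between 1 and v ^ n, and v ^ n - 1 is v - 1
times a geometric sum. Comparing with the base point 1 only is what permits s < 1, where the power
is not Lipschitz at 0. -/
theorem exists_abs_rpow_sub_one_le (s : ℝ) (hs : 0 ≤ s) :
    ∃ K : ℝ, 1 ≤ K ∧ ∀ v : ℝ, 0 ≤ v → v ≤ 4 → |v ^ s - 1| ≤ K * |v - 1| := by
  obtain ⟨n, hn⟩ := exists_nat_ge s
  have key : ∀ v : ℝ, 0 ≤ v → v ≤ 4 →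
      |v ^ n - 1| ≤ (∑ i ∈ Finset.range n, (4 : ℝ) ^ i) * |v - 1| := by
    intro v hv hv4
    rw [← geom_sum_mul, abs_mul]
    gcongr
    rw [abs_of_nonneg (by positivity)]
    gcongr
  refine ⟨(∑ i ∈ Finset.range n, (4 : ℝ) ^ i) + 1, by
    linarith [Finset.sum_nonneg (s := Finset.range n) fun i _ => pow_nonneg (zero_le_four (α := ℝ)) i],
    fun v hv hv4 => ?_⟩
  have h1 : |v ^ s - 1| ≤ |v ^ n - 1| + |v - 1| := by
    rcases eq_or_lt_of_le hv with rfl | hv0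
    · rcases eq_or_lt_of_le hs with rfl | hs0
      · simpa using add_nonneg (abs_nonneg ((0 : ℝ) ^ n - 1)) zero_le_one
      · simp only [Real.zero_rpow hs0.ne', zero_sub, abs_neg, abs_one]
        linarith [abs_nonneg ((0 : ℝ) ^ n - 1)]
    · have h0 := abs_nonneg (v - 1)
      rcases le_total 1 v with h | h
      · have := Real.rpow_le_rpow_of_exponent_le h hn
        rw [Real.rpow_natCast] at this
        rw [abs_of_nonneg (sub_nonneg.2 (Real.one_le_rpow h hs)),
          abs_of_nonneg (sub_nonneg.2 (one_le_pow₀ h))]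
        linarith
      · have := Real.rpow_le_rpow_of_exponent_ge hv0 h hn
        rw [Real.rpow_natCast] at this
        rw [abs_of_nonpos (sub_nonpos.2 (Real.rpow_le_one hv h hs)),
          abs_of_nonpos (sub_nonpos.2 (pow_le_one₀ hv h))]
        linarith
  linarith [key v hv hv4]

theorem exists_rpow_le_quadratic (r : ℝ) (hr : 1 ≤ r) :
    ∃ K : ℝ, 0 ≤ K ∧ ∀ v : ℝ, 0 ≤ v → v ≤ 4 → v ^ r ≤ 1 + r * (v - 1) + K * (v - 1) ^ 2 := by
  obtain ⟨K, hK, h⟩ := exists_abs_rpow_sub_one_le (r - 1) (by linarith)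
  refine ⟨r * K, by positivity, fun v hv hv4 => ?_⟩
  have hsq : (v ^ (r - 1) - 1) * (v - 1) ≤ K * (v - 1) ^ 2 := by
    calc (v ^ (r - 1) - 1) * (v - 1) ≤ |v ^ (r - 1) - 1| * |v - 1| := by
          rw [← abs_mul]; exact le_abs_self _
      _ ≤ K * |v - 1| * |v - 1| := by gcongr; exact h v hv hv4
      _ = K * (v - 1) ^ 2 := by rw [mul_assoc, abs_mul_abs_self]; ring
  rcases eq_or_lt_of_le hv with rfl | hv0
  · rw [Real.zero_rpow (by linarith)]
    nlinarith
  -- Bernoulli at 1/v, multiplied by v ^ r, is the tangent inequality at v: v ^ r ≤ 1 + r v ^ (r -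
  -- 1) (v - 1). Replacing v ^ (r - 1) by 1 costs only the quadratic term.
  · have hb := one_add_mul_self_le_rpow_one_add (s := v⁻¹ - 1) (by
      linarith [inv_nonneg.2 hv]) hr
    have e1 : (1 + (v⁻¹ - 1)) ^ r * v ^ r = 1 := by
      rw [← Real.mul_rpow (by simpa using hv) hv]
      simp [hv0.ne']
    have e2 : v⁻¹ * v ^ r = v ^ (r - 1) := by
      rw [Real.rpow_sub_one hv0.ne']; ring
    have := mul_le_mul_of_nonneg_right hb (Real.rpow_nonneg hv r)
    rw [e1] at this
    have e3 : v ^ r = v * v ^ (r - 1) := by rw [← e2]; field_simp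
    have : v ^ r ≤ 1 + r * v ^ (r - 1) * (v - 1) := by
      have : (1 + r * (v⁻¹ - 1)) * v ^ r = v ^ r + r * (v ^ (r - 1) - v * v ^ (r - 1)) := by
        rw [← e3, ← e2]; ring
      nlinarith
    nlinarith

variable {E : Type*} [NormedAddCommGroup E] [InnerProductSpace ℝ E]

/-- A second-order expansion whose linear term is kept exactly, since it is the one that will have
zero conditional mean. If ‖x‖ ≤ ‖y‖, all is absorbed by the error terms; otherwise v = ‖x + y‖² /
‖x‖² lies in [0, 4] and the quadratic bound applies with exponent q / 2. -/
theorem exists_norm_add_rpow_le (q : ℝ) (hq : 2 ≤ q) :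
    ∃ C : ℝ, 0 ≤ C ∧ ∀ x y : E, ‖x + y‖ ^ q ≤
      ‖x‖ ^ q + q * ‖x‖ ^ (q - 2) * inner ℝ x y + C * (‖x‖ ^ (q - 2) * ‖y‖ ^ 2 + ‖y‖ ^ q) := by
  obtain ⟨K, hK, h⟩ := exists_rpow_le_quadratic (q / 2) (by linarith)
  refine ⟨2 ^ q + q + 9 * K, by positivity, fun x y => ?_⟩
  have hin := abs_le.1 (abs_real_inner_le_norm x y)
  have hxq : 0 ≤ ‖x‖ ^ (q - 2) := by positivity
  have hxy := norm_add_le x y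
  rcases le_or_gt ‖x‖ ‖y‖ with hle | hlt
  · have h1 : ‖x + y‖ ^ q ≤ 2 ^ q * ‖y‖ ^ q := by
      rw [← Real.mul_rpow (by norm_num) (norm_nonneg _)]
      gcongr
      linarith
    have h2 : -(‖x‖ ^ (q - 2) * ‖y‖ ^ 2) ≤ ‖x‖ ^ (q - 2) * inner ℝ x y := by
      rw [← mul_neg]
      gcongr
      nlinarith [norm_nonneg y]
    have h3 : 0 ≤ ‖x‖ ^ q := by positivity
    have h4 : 0 ≤ ‖y‖ ^ q := by positivity
    have h5 : 0 ≤ ‖x‖ ^ (q - 2) * ‖y‖ ^ 2 := by positivity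
    have h6 : (0 : ℝ) ≤ 2 ^ q := by positivity
    have h7 := mul_le_mul_of_nonneg_left h2 (by linarith : 0 ≤ q)
    have h8 : 0 ≤ (2 ^ q + 9 * K) * (‖x‖ ^ (q - 2) * ‖y‖ ^ 2) := by positivity
    have h9 : 0 ≤ (q + 9 * K) * ‖y‖ ^ q := by positivity
    linarith
  · have hx : 0 < ‖x‖ := (norm_nonneg y).trans_lt hlt
    set b : ℝ := 2 * inner ℝ x y + ‖y‖ ^ 2 with hb
    have hsq : ‖x + y‖ ^ 2 = ‖x‖ ^ 2 + b := by rw [norm_add_sq_real]; ring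
    set v : ℝ := ‖x + y‖ ^ 2 / ‖x‖ ^ 2 with hv
    have hv1 : v - 1 = b / ‖x‖ ^ 2 := by rw [hv, hsq]; field_simp; ring
    have hv4 : v ≤ 4 := by
      rw [hv, div_le_iff₀ (by positivity)]
      nlinarith [norm_nonneg (x + y)]
    have key := h v (by positivity) hv4
    have hbq : b ^ 2 ≤ 9 * ‖x‖ ^ 2 * ‖y‖ ^ 2 := by
      have : |b| ≤ 3 * ‖x‖ * ‖y‖ := by
        rw [abs_le]
        constructor <;> nlinarith [norm_nonneg y]
      calc b ^ 2 = |b| ^ 2 := (sq_abs b).symm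
        _ ≤ (3 * ‖x‖ * ‖y‖) ^ 2 := by gcongr
        _ = _ := by ring
    have e0 : ‖x‖ ^ q = ‖x‖ ^ (q - 2) * ‖x‖ ^ 2 := by
      rw [← Real.rpow_natCast ‖x‖ 2, ← Real.rpow_add hx]; norm_num
    have e1 : ‖x + y‖ ^ q = v ^ (q / 2) * ‖x‖ ^ q := by
      have aux : ∀ z : E, ‖z‖ ^ q = (‖z‖ ^ 2) ^ (q / 2) := fun z => by
        rw [← Real.rpow_natCast ‖z‖ 2, ← Real.rpow_mul (norm_nonneg z)]
        congr 1; push_cast; ring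
      rw [aux x, ← Real.mul_rpow (by positivity) (by positivity), hv,
        div_mul_cancel₀ _ (by positivity), aux]
    have e2 : (v - 1) * ‖x‖ ^ q = ‖x‖ ^ (q - 2) * b := by rw [hv1, e0]; field_simp
    have e3 : (v - 1) ^ 2 * ‖x‖ ^ q ≤ 9 * (‖x‖ ^ (q - 2) * ‖y‖ ^ 2) := by
      have : (v - 1) ^ 2 * ‖x‖ ^ q = ‖x‖ ^ (q - 2) * (b ^ 2 / ‖x‖ ^ 2) := by
        rw [hv1, e0]; field_simp
      rw [this, mul_left_comm]
      gcongr
      rw [div_le_iff₀ (by positivity)]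
      linarith
    have h1 := mul_le_mul_of_nonneg_right key (by positivity : 0 ≤ ‖x‖ ^ q)
    rw [← e1] at h1
    have h2 : (1 + q / 2 * (v - 1) + K * (v - 1) ^ 2) * ‖x‖ ^ q =
        ‖x‖ ^ q + q / 2 * (‖x‖ ^ (q - 2) * b) + K * ((v - 1) ^ 2 * ‖x‖ ^ q) := by
      rw [← e2]; ring
    have h3 := mul_le_mul_of_nonneg_left e3 hK
    have h4 : 0 ≤ (2 ^ q + q + 9 * K) * ‖y‖ ^ q := by positivity
    have h5 : 0 ≤ (2 ^ q + q / 2) * (‖x‖ ^ (q - 2) * ‖y‖ ^ 2) := by positivity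
    rw [hb] at h2
    linarith

/-- A form of Young's inequality, by comparing a with D b: if a is larger, C b² ≤ a² / 2; otherwise
a ^ (q - 2) is at most (D b) ^ (q - 2). -/
theorem exists_rpow_sub_two_mul_sq_le (q : ℝ) (hq : 2 ≤ q) (C : ℝ) (hC : 0 ≤ C) :
    ∃ K : ℝ, 0 ≤ K ∧ ∀ a b : ℝ, 0 ≤ a → 0 ≤ b →
      C * (a ^ (q - 2) * b ^ 2) ≤ 1 / 2 * a ^ q + K * b ^ q := by
  have hpow : ∀ a : ℝ, 0 ≤ a → a ^ (q - 2) * a ^ 2 = a ^ q := fun a ha => by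
    rw [← Real.rpow_natCast a 2, ← Real.rpow_add_of_nonneg ha (by linarith) (by norm_num)]
    norm_num
  set D : ℝ := 2 * C + 1 with hD
  have hD1 : 1 ≤ D := by linarith
  refine ⟨C * D ^ (q - 2), by positivity, fun a b ha hb => ?_⟩
  have h1 : 0 ≤ a ^ q := by positivity
  have h2 : 0 ≤ b ^ q := by positivity
  have h3 : 0 ≤ a ^ (q - 2) := by positivity
  rcases le_total (D * b) a with h | h
  · have : C * b ^ 2 ≤ 1 / 2 * a ^ 2 := by
      have : D * b * b ≤ a * a := by
        have hba : b ≤ a := by nlinarith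
        exact mul_le_mul h hba hb ha
      nlinarith [mul_self_nonneg b]
    have h4 := mul_le_mul_of_nonneg_left this h3
    have h5 : 0 ≤ C * D ^ (q - 2) * b ^ q := by positivity
    nlinarith [hpow a ha]
  · have : a ^ (q - 2) ≤ D ^ (q - 2) * b ^ (q - 2) := by
      rw [← Real.mul_rpow (by linarith) hb]
      exact Real.rpow_le_rpow ha h (by linarith)
    have h4 := mul_le_mul_of_nonneg_left (mul_le_mul_of_nonneg_right this (sq_nonneg b)) hC
    have h5 : C * (D ^ (q - 2) * b ^ (q - 2) * b ^ 2) = C * D ^ (q - 2) * b ^ q := by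
      rw [← hpow b hb]; ring
    linarith

theorem exists_norm_average_rpow_le (q : ℝ) (hq : 2 ≤ q) :
    ∃ K : ℝ, 0 ≤ K ∧ ∀ (γ : ℝ), 0 ≤ γ → γ ≤ 1 → ∀ x u : E, ‖(1 - γ) • x + γ • u‖ ^ q ≤
      (1 - γ / 2) * ‖x‖ ^ q
        + q * ‖(1 - γ) • x‖ ^ (q - 2) * inner ℝ ((1 - γ) • x) (γ • u)
        + K * γ ^ (1 + q / 2) * ‖u‖ ^ q := by
  obtain ⟨C, hC, h⟩ := exists_norm_add_rpow_le (E := E) q hq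
  obtain ⟨K, hK, hY⟩ := exists_rpow_sub_two_mul_sq_le q hq C hC
  refine ⟨K + C, by positivity, fun γ h0 h1 x u => ?_⟩
  have hs := h ((1 - γ) • x) (γ • u)
  have hn : ‖(1 - γ) • x‖ = (1 - γ) * ‖x‖ := by
    rw [norm_smul, Real.norm_of_nonneg (by linarith)]
  have hu : ‖γ • u‖ = γ * ‖u‖ := by rw [norm_smul, Real.norm_of_nonneg h0]
  have hxq : 0 ≤ ‖x‖ ^ q := by positivity
  have e1 : ‖(1 - γ) • x‖ ^ q ≤ (1 - γ) * ‖x‖ ^ q := by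
    rw [hn, Real.mul_rpow (by linarith) (norm_nonneg _)]
    gcongr
    rcases eq_or_lt_of_le h1 with rfl | h1'
    · rw [sub_self, Real.zero_rpow (by linarith)]
    · exact (Real.rpow_le_rpow_of_exponent_ge (by linarith) (by linarith)
        (by linarith : (1 : ℝ) ≤ q)).trans_eq (Real.rpow_one _)
  have e2 : ‖(1 - γ) • x‖ ^ (q - 2) ≤ ‖x‖ ^ (q - 2) := by
    refine Real.rpow_le_rpow (norm_nonneg _) ?_ (by linarith)
    rw [hn]
    nlinarith [norm_nonneg x]
  have e3 : ‖γ • u‖ ^ q ≤ γ ^ (1 + q / 2) * ‖u‖ ^ q := by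
    rw [hu, Real.mul_rpow h0 (norm_nonneg _)]
    refine mul_le_mul_of_nonneg_right ?_ (by positivity)
    rcases eq_or_lt_of_le h0 with rfl | h0'
    · rw [Real.zero_rpow (by linarith), Real.zero_rpow (by linarith)]
    · exact Real.rpow_le_rpow_of_exponent_ge h0' h1 (by linarith)
  have e4 : C * (‖(1 - γ) • x‖ ^ (q - 2) * ‖γ • u‖ ^ 2) ≤
      γ / 2 * ‖x‖ ^ q + K * (γ ^ (1 + q / 2) * ‖u‖ ^ q) := by
    -- Splitting γ² = γ · (√γ)² and applying Young to √γ ‖u‖ spends half of the contraction γ and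
    -- leaves γ · γ ^ (q / 2): this is the origin of the exponent 1 + q / 2.
    have hy := mul_le_mul_of_nonneg_left
      (hY ‖x‖ (Real.sqrt γ * ‖u‖) (norm_nonneg _) (by positivity)) h0
    have a1 : (Real.sqrt γ * ‖u‖) ^ 2 = γ * ‖u‖ ^ 2 := by rw [mul_pow, Real.sq_sqrt h0]
    have a2 : γ * (Real.sqrt γ * ‖u‖) ^ q = γ ^ (1 + q / 2) * ‖u‖ ^ q := by
      rw [Real.mul_rpow (Real.sqrt_nonneg _) (norm_nonneg _), Real.sqrt_eq_rpow,
        ← Real.rpow_mul h0, Real.rpow_add_of_nonneg h0 zero_le_one (by linarith), Real.rpow_one]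
      ring_nf
    rw [a1] at hy
    calc C * (‖(1 - γ) • x‖ ^ (q - 2) * ‖γ • u‖ ^ 2)
        ≤ C * (‖x‖ ^ (q - 2) * ‖γ • u‖ ^ 2) := by gcongr
      _ = γ * (C * (‖x‖ ^ (q - 2) * (γ * ‖u‖ ^ 2))) := by rw [hu]; ring
      _ ≤ γ * (1 / 2 * ‖x‖ ^ q + K * (Real.sqrt γ * ‖u‖) ^ q) := hy
      _ = γ / 2 * ‖x‖ ^ q + K * (γ * (Real.sqrt γ * ‖u‖) ^ q) := by ring
      _ = _ := by rw [a2]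
  have e5 := mul_le_mul_of_nonneg_left e3 hC
  linarith

theorem rpow_sub_two_mul_mul_le (q : ℝ) (hq : 2 ≤ q) {a b : ℝ} (ha : 0 ≤ a) (hb : 0 ≤ b) :
    a ^ (q - 2) * (a * b) ≤ a ^ q + b ^ q := by
  have hpow : ∀ c : ℝ, 0 ≤ c → c ^ (q - 2) * (c * c) = c ^ q := fun c hc => by
    rw [← sq, ← Real.rpow_natCast c 2,
      ← Real.rpow_add_of_nonneg hc (by linarith) (by norm_num)]
    norm_num
  have h1 : 0 ≤ a ^ q := by positivity
  have h2 : 0 ≤ b ^ q := by positivity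
  rcases le_total a b with h | h
  · have : a ^ (q - 2) * (a * b) ≤ b ^ (q - 2) * (b * b) := by
      gcongr
    linarith [hpow b hb]
  · have : a ^ (q - 2) * (a * b) ≤ a ^ (q - 2) * (a * a) := by gcongr
    linarith [hpow a ha]

end Inequalities

/-! ### Almost sure convergence of running averages of martingale differences. -/

section RunningAverage

/-- If `a n + ∑ k < n, γ k * a k` converges, where `a ≥ 0` and the nonnegative weights `γ` have
infinite sum, then `a` tends to zero. -/
theorem tendsto_zero_of_tendsto_add_sum {a γ : ℕ → ℝ} (ha : ∀ n, 0 ≤ a n) (hγ : ∀ n, 0 ≤ γ n)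
    (hγ_sum : Tendsto (fun N : ℕ => ∑ n ∈ Finset.range N, γ n) atTop atTop) {c : ℝ}
    (h : Tendsto (fun n => a n + ∑ k ∈ Finset.range n, γ k * a k) atTop (𝓝 c)) :
    Tendsto a atTop (𝓝 0) := by
  have hnn : ∀ k, 0 ≤ γ k * a k := fun k => mul_nonneg (hγ k) (ha k)
  obtain ⟨b, hb⟩ := h.bddAbove_range
  have hS : Summable fun k => γ k * a k :=
    summable_of_sum_range_le hnn fun n => by
      linarith [hb (mem_range_self n), ha n]
  have hlim := h.sub hS.hasSum.tendsto_sum_nat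
  simp only [add_sub_cancel_right] at hlim
  set l := c - ∑' k, γ k * a k
  have hl0 : 0 ≤ l := ge_of_tendsto' hlim ha
  rcases eq_or_lt_of_le hl0 with hl | hl
  · rwa [← hl] at hlim
  exfalso
  obtain ⟨M, hM⟩ := eventually_atTop.1 (hlim.eventually (lt_mem_nhds (half_lt_self hl)))
  -- If the limit l of a were positive, eventually a > l / 2, so γ would be dominated by (2 / l) γ
  -- a, which is summable.
  have hγS : Summable fun k => γ (k + M) := by
    have h1 := ((summable_nat_add_iff M).2 hS).mul_left (2 / l)
    refine Summable.of_nonneg_of_le (fun k => hγ _) (fun k => ?_) h1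
    have h2 := (hM (k + M) (by omega)).le
    have h3 := hγ (k + M)
    calc γ (k + M) = 2 / l * (γ (k + M) * (l / 2)) := by field_simp
      _ ≤ _ := by gcongr
  exact not_tendsto_atTop_of_tendsto_nhds
    ((summable_nat_add_iff M).1 hγS).hasSum.tendsto_sum_nat hγ_sum

theorem ae_summable_of_integral_le {Ω : Type*} [MeasurableSpace Ω] {μ : Measure Ω}
    {F : ℕ → Ω → ℝ} (hF : ∀ n, Integrable (F n) μ) (h0 : ∀ n ω, 0 ≤ F n ω)
    {b : ℕ → ℝ} (hb : Summable b) (hFb : ∀ n, ∫ ω, F n ω ∂μ ≤ b n) :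
    ∀ᵐ ω ∂μ, Summable fun n => F n ω := by
  have hmeas : ∀ n, AEMeasurable (fun ω => ENNReal.ofReal (F n ω)) μ := fun n =>
    (hF n).aestronglyMeasurable.aemeasurable.ennreal_ofReal
  have hfin : ∫⁻ ω, ∑' n, ENNReal.ofReal (F n ω) ∂μ ≠ ∞ := by
    rw [lintegral_tsum hmeas]
    have : ∀ n, ∫⁻ ω, ENNReal.ofReal (F n ω) ∂μ ≤ ENNReal.ofReal (b n) := fun n => by
      rw [← ofReal_integral_eq_lintegral_ofReal (hF n) (ae_of_all _ (h0 n))]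
      exact ENNReal.ofReal_le_ofReal (hFb n)
    refine ne_top_of_le_ne_top ?_ (ENNReal.tsum_le_tsum this)
    exact hb.tsum_ofReal_ne_top
  filter_upwards [ae_lt_top' (AEMeasurable.tsum hmeas) hfin] with ω hω
  have := ENNReal.summable_toReal hω.ne
  simpa only [ENNReal.toReal_ofReal (h0 _ ω)] using this

/-- The weighted running average with initial value `0` and weights `γ`. -/
noncomputable def runningAverage {E : Type*} [NormedAddCommGroup E] [NormedSpace ℝ E]
    (γ : ℕ → ℝ) (u : ℕ → E) : ℕ → E
  | 0 => 0
  | n + 1 => (1 - γ n) • runningAverage γ u n + γ n • u n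

variable {Ω : Type*} {m0 : MeasurableSpace Ω} {μ : Measure Ω}
  {E : Type*} [NormedAddCommGroup E]

theorem integrable_norm_rpow_of_memLp {q : ℝ} (hq : 0 < q) {X : Ω → E}
    (hX : MemLp X (ENNReal.ofReal q) μ) : Integrable (fun ω => ‖X ω‖ ^ q) μ := by
  have := hX.integrable_norm_rpow (by simpa using hq) (by simp)
  rwa [ENNReal.toReal_ofReal hq.le] at this

variable [InnerProductSpace ℝ E]

theorem integrable_rpow_mul_inner {q : ℝ} (hq : 2 ≤ q) {X Y : Ω → E}
    (hX : MemLp X (ENNReal.ofReal q) μ) (hY : MemLp Y (ENNReal.ofReal q) μ) :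
    Integrable (fun ω => q * ‖X ω‖ ^ (q - 2) * inner ℝ (X ω) (Y ω)) μ := by
  have hXm := hX.aestronglyMeasurable
  refine Integrable.mono' (((integrable_norm_rpow_of_memLp (by linarith) hX).add
    (integrable_norm_rpow_of_memLp (by linarith) hY)).const_mul q) ?_ (ae_of_all _ fun ω => ?_)
  · refine AEStronglyMeasurable.mul ?_ (hXm.inner hY.aestronglyMeasurable)
    exact ((hXm.norm.aemeasurable.pow_const (q - 2)).const_mul q).aestronglyMeasurable
  · have hp : 0 ≤ ‖X ω‖ ^ (q - 2) := by positivity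
    rw [norm_mul, norm_mul, Real.norm_of_nonneg (by linarith : 0 ≤ q), Real.norm_of_nonneg hp,
      mul_assoc]
    refine mul_le_mul_of_nonneg_left ?_ (by linarith)
    refine le_trans ?_ (rpow_sub_two_mul_mul_le q hq (norm_nonneg (X ω)) (norm_nonneg (Y ω)))
    gcongr
    exact norm_inner_le_norm _ _

variable [CompleteSpace E]

theorem condExp_inner_eq_zero {m : MeasurableSpace Ω} {X Y : Ω → E}
    (hX : StronglyMeasurable[m] X) (hXY : Integrable (fun ω => inner ℝ (X ω) (Y ω)) μ)
    (hY : Integrable Y μ) (h : μ[Y | m] =ᵐ[μ] 0) :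
    μ[fun ω => inner ℝ (X ω) (Y ω) | m] =ᵐ[μ] 0 := by
  let B : E →L[ℝ] E →L[ℝ] ℝ := (innerₗ E).mkContinuous₂ 1 fun x y => by
    simpa using norm_inner_le_norm (𝕜 := ℝ) x y
  have hB : ∀ x y, B x y = inner ℝ x y := fun x y => rfl
  have := condExp_bilin_of_stronglyMeasurable_left (μ := μ) B hX (by simpa only [hB] using hXY) hY
  simp only [hB] at this
  filter_upwards [this, h] with ω h1 h2
  rw [h1, h2]
  simp

variable [IsFiniteMeasure μ]

/-- The running average of martingale differences that are bounded in `L^q` tends to zero almost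
surely if the weights have infinite sum and summable powers of order `1 + q / 2`. -/
theorem ae_tendsto_runningAverage {ℱ : Filtration ℕ m0} {U : ℕ → Ω → E} {q C : ℝ} (hq : 2 ≤ q)
    (hU : ∀ n, StronglyMeasurable[ℱ (n + 1)] (U n))
    (hUq : ∀ n, MemLp (U n) (ENNReal.ofReal q) μ) (hUC : ∀ n, ∫ ω, ‖U n ω‖ ^ q ∂μ ≤ C)
    (hU0 : ∀ n, μ[U n | ℱ n] =ᵐ[μ] 0) {γ : ℕ → ℝ} (hγ0 : ∀ n, 0 ≤ γ n) (hγ1 : ∀ n, γ n ≤ 1)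
    (hγ_sum : Tendsto (fun N : ℕ => ∑ n ∈ Finset.range N, γ n) atTop atTop)
    (hγ_pow : Summable fun n : ℕ => γ n ^ (1 + q / 2)) :
    ∀ᵐ ω ∂μ, Tendsto (runningAverage γ fun k => U k ω) atTop (𝓝 0) := by
  have hq0 : 0 < q := by linarith
  obtain ⟨K, hK, hstep⟩ := exists_norm_average_rpow_le (E := E) q hq
  set N : ℕ → Ω → E := fun n ω => runningAverage γ (fun k => U k ω) n with hN
  have hN0 : N 0 = fun _ => 0 := rfl
  have hNs : ∀ n, N (n + 1) = fun ω => (1 - γ n) • N n ω + γ n • U n ω := fun n => rfl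
  have hNm : ∀ n, StronglyMeasurable[ℱ n] (N n) := by
    intro n
    induction n with
    | zero => rw [hN0]; exact stronglyMeasurable_const
    | succ n ih =>
      rw [hNs]
      exact ((ih.mono (ℱ.mono n.le_succ)).const_smul _).add ((hU n).const_smul _)
  have hNq : ∀ n, MemLp (N n) (ENNReal.ofReal q) μ := by
    intro n
    induction n with
    | zero => rw [hN0]; exact MemLp.zero'
    | succ n ih =>
      rw [hNs]
      exact (ih.const_smul _).add ((hUq n).const_smul _)
  set β : ℕ → Ω → ℝ := fun n ω => K * γ n ^ (1 + q / 2) * ‖U n ω‖ ^ q with hβ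
  have hβ0 : ∀ n ω, 0 ≤ β n ω := fun n ω => by have := hγ0 n; positivity
  have hβi : ∀ n, Integrable (β n) μ := fun n =>
    (integrable_norm_rpow_of_memLp hq0 (hUq n)).const_mul _
  have hβC : ∀ n, ∫ ω, β n ω ∂μ ≤ K * γ n ^ (1 + q / 2) * C := fun n => by
    rw [hβ, integral_const_mul]
    have := hγ0 n
    exact mul_le_mul_of_nonneg_left (hUC n) (by positivity)
  have hbS : Summable fun n => K * γ n ^ (1 + q / 2) * C := (hγ_pow.mul_left K).mul_right C
  set g : ℕ → Ω → ℝ := fun n ω => q * ‖(1 - γ n) • N n ω‖ ^ (q - 2) *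
    inner ℝ ((1 - γ n) • N n ω) (γ n • U n ω) with hg
  have hgi : ∀ n, Integrable (g n) μ := fun n =>
    integrable_rpow_mul_inner hq ((hNq n).const_smul _) ((hUq n).const_smul _)
  have hg0 : ∀ n, μ[g n | ℱ n] =ᵐ[μ] 0 := by
    intro n
    -- All factors known at time n go into the left slot, so that they can be pulled out of the
    -- conditional expectation.
    have hg' : g n = fun ω => inner ℝ ((q * ‖(1 - γ n) • N n ω‖ ^ (q - 2) * γ n) •
        ((1 - γ n) • N n ω)) (U n ω) := by
      funext ω
      rw [real_inner_smul_left]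
      simp only [hg]
      rw [real_inner_smul_right]
      ring
    have hi := hgi n
    rw [hg'] at hi ⊢
    have hsm := (hNm n).const_smul (1 - γ n)
    refine condExp_inner_eq_zero ?_ hi ((hUq n).integrable ?_) (hU0 n)
    · refine StronglyMeasurable.smul ?_ hsm
      exact (((hsm.norm.measurable.pow_const (q - 2)).const_mul q).mul_const _).stronglyMeasurable
    · rw [← ENNReal.ofReal_one]
      exact ENNReal.ofReal_le_ofReal (by linarith)
  -- The accumulated contraction is added and the accumulated error removed, which makes V a
  -- supermartingale with nonpositive mean.
  set V : ℕ → Ω → ℝ := fun n ω => ‖N n ω‖ ^ q + ∑ k ∈ Finset.range n, γ k / 2 * ‖N k ω‖ ^ q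
    - ∑ k ∈ Finset.range n, β k ω with hV
  have hVstep : ∀ n ω, V (n + 1) ω ≤ V n ω + g n ω := by
    intro n ω
    have := hstep (γ n) (hγ0 n) (hγ1 n) (N n ω) (U n ω)
    simp only [hV, hg, hβ, hNs, Finset.sum_range_succ]
    linarith
  have hVi : ∀ n, Integrable (V n) μ := fun n =>
    ((integrable_norm_rpow_of_memLp hq0 (hNq n)).add (integrable_finsetSum _ fun k _ =>
      (integrable_norm_rpow_of_memLp hq0 (hNq k)).const_mul _)).sub
        (integrable_finsetSum _ fun k _ => hβi k)
  have hVm : ∀ n, StronglyMeasurable[ℱ n] (V n) := by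
    intro n
    have hNp : ∀ k, k ≤ n → StronglyMeasurable[ℱ n] fun ω => ‖N k ω‖ ^ q := fun k hk =>
      (((hNm k).mono (ℱ.mono hk)).norm.measurable.pow_const q).stronglyMeasurable
    refine ((hNp n le_rfl).add (Finset.stronglyMeasurable_fun_sum _ fun k hk => ?_)).sub
      (Finset.stronglyMeasurable_fun_sum _ fun k hk => ?_)
    · exact (hNp k (Finset.mem_range.1 hk).le).const_mul _
    · exact ((((hU k).mono (ℱ.mono (Finset.mem_range.1 hk))).norm.measurable.pow_const
        q).stronglyMeasurable).const_mul _
  have hsub : Submartingale (fun n => -V n) ℱ μ := by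
    refine submartingale_of_condExp_sub_nonneg_nat (fun n => (hVm n).neg) (fun n => (hVi n).neg)
      fun n => ?_
    have h1 : μ[-g n | ℱ n] ≤ᵐ[μ] μ[-V (n + 1) - -V n | ℱ n] :=
      condExp_mono (hgi n).neg ((hVi (n + 1)).neg.sub (hVi n).neg) (ae_of_all _ fun ω => by
        have := hVstep n ω
        simp only [Pi.neg_apply, Pi.sub_apply]
        linarith)
    filter_upwards [h1, condExp_neg (μ := μ) (g n) (ℱ n), hg0 n] with ω h1 h2 h3
    rw [h2, Pi.neg_apply, h3] at h1
    simpa using h1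
  have hVint : ∀ n, ∫ ω, V n ω ∂μ ≤ 0 := by
    intro n
    induction n with
    | zero =>
      refine le_of_eq ?_
      simp [hV, hN0, Real.zero_rpow hq0.ne']
    | succ n ih =>
      have h1 : ∫ ω, g n ω ∂μ = 0 := by
        rw [← integral_condExp (ℱ.le n), integral_congr_ae (hg0 n)]
        simp
      have h2 := integral_mono (hVi (n + 1)) ((hVi n).add (hgi n)) (hVstep n)
      simp only [Pi.add_apply] at h2
      rw [integral_add (hVi n) (hgi n), h1] at h2
      linarith
  set R : ℝ := 2 * ∑' n, K * γ n ^ (1 + q / 2) * C with hR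
  have hC0 : 0 ≤ C := (integral_nonneg fun ω => by positivity).trans (hUC 0)
  have hbound : ∀ n, eLpNorm (-V n) 1 μ ≤ (R.toNNReal : ℝ≥0∞) := by
    intro n
    have hsi := integrable_finsetSum (Finset.range n) fun k _ => hβi k
    have h1 : ∫ ω, ‖V n ω‖ ∂μ ≤ R := by
      -- The only negative part of V is the error sum, so the L¹ bound follows from the mean of V
      -- being nonpositive.
      have h2 : ∀ ω, ‖V n ω‖ ≤ V n ω + 2 * ∑ k ∈ Finset.range n, β k ω := by
        intro ω
        have h3 : 0 ≤ ∑ k ∈ Finset.range n, β k ω := Finset.sum_nonneg fun k _ => hβ0 k ω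
        have h4 : 0 ≤ ∑ k ∈ Finset.range n, γ k / 2 * ‖N k ω‖ ^ q :=
          Finset.sum_nonneg fun k _ => by have := hγ0 k; positivity
        have h5 : 0 ≤ ‖N n ω‖ ^ q := by positivity
        rw [Real.norm_eq_abs, abs_le]
        simp only [hV]
        constructor <;> linarith
      have h6 := integral_mono (hVi n).norm ((hVi n).add (hsi.const_mul 2)) h2
      simp only [Pi.add_apply] at h6
      rw [integral_add (hVi n) (hsi.const_mul 2), integral_const_mul,
        integral_finsetSum _ fun k _ => hβi k] at h6
      have h7 : ∑ k ∈ Finset.range n, ∫ ω, β k ω ∂μ ≤ ∑' n, K * γ n ^ (1 + q / 2) * C :=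
        (Finset.sum_le_sum fun k _ => hβC k).trans (hbS.sum_le_tsum _ fun k _ => by
          have := hγ0 k; positivity)
      linarith [hVint n]
    rw [eLpNorm_neg, eLpNorm_one_eq_lintegral_enorm,
      ← ofReal_integral_norm_eq_lintegral_enorm (hVi n)]
    exact ENNReal.ofReal_le_ofReal h1
  filter_upwards [hsub.exists_ae_tendsto_of_bdd hbound,
    ae_summable_of_integral_le hβi hβ0 hbS hβC] with ω ⟨c, hc⟩ hS
  have h1 := hc.neg.add hS.hasSum.tendsto_sum_nat
  have h2 : Tendsto (fun n => ‖N n ω‖ ^ q) atTop (𝓝 0) := by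
    refine tendsto_zero_of_tendsto_add_sum (γ := fun k => γ k / 2) (fun n => by positivity)
      (fun n => by have := hγ0 n; positivity) ?_ (h1.congr fun n => ?_)
    · simp_rw [← Finset.sum_div]
      exact hγ_sum.atTop_div_const two_pos
    · simp [hV]
  rw [tendsto_zero_iff_norm_tendsto_zero]
  have h3 := h2.rpow_const (p := 1 / q) (Or.inr (by positivity))
  rw [Real.zero_rpow (by positivity)] at h3
  refine h3.congr fun n => ?_
  rw [← Real.rpow_mul (norm_nonneg _), mul_one_div_cancel hq0.ne', Real.rpow_one]

end RunningAverage

/-! ### From perturbed gradient descent to asymptotic pseudotrajectories. -/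

section Deterministic

variable {d : ℕ}

theorem LipschitzSmooth.lipschitzWith_neg_gradient {f : Pt d → ℝ} {G L : ℝ}
    (hf : LipschitzSmooth f G L) : LipschitzWith L.toNNReal fun x => -gradient f x := by
  refine LipschitzWith.of_dist_le_mul fun x y => ?_
  rw [dist_neg_neg, dist_eq_norm, dist_eq_norm]
  refine (hf.norm_gradient_sub_le y x).trans ?_
  gcongr
  exact Real.le_coe_toNNReal L

theorem LipschitzSmooth.continuous_gradient {f : Pt d → ℝ} {G L : ℝ}
    (hf : LipschitzSmooth f G L) : Continuous (gradient f) := by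
  exact hf.lipschitzWith_neg_gradient.continuous.neg.congr fun x => neg_neg _

theorem gronwallBound_self (K ε x : ℝ) : gronwallBound ε K ε x = ε * gronwallBound 1 K 1 x := by
  unfold gronwallBound
  split_ifs <;> ring

/-- A curve that is asymptotic to a curve `w` with `w' + ∇f(w) → 0` is an asymptotic
pseudotrajectory of the gradient flow. -/
theorem isAPT_of_approx_solution {f : Pt d → ℝ} {G L : ℝ} (hf : LipschitzSmooth f G L)
    {Φ : ℝ → Pt d → Pt d} (hΦ : IsGradientFlow f Φ) {y w : ℝ → Pt d}
    (hc : ∀ᶠ t in atTop, ContinuousAt w t)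
    (hyw : Tendsto (fun t => y t - w t) atTop (𝓝 0))
    (hw : ∀ ε > 0, ∀ᶠ t in atTop, ∃ w' : Pt d,
      HasDerivWithinAt w w' (Ici t) t ∧ ‖w' + gradient f (w t)‖ ≤ ε) : IsAPT Φ y := by
  intro T hT
  rw [ENNReal.tendsto_nhds_zero]
  intro η hη
  obtain ⟨e, he0, heη⟩ := ENNReal.lt_iff_exists_nnreal_btwn.1 hη
  have he : (0 : ℝ) < e := by exact_mod_cast he0
  set B := gronwallBound 1 L.toNNReal 1 T with hB
  have hmono : ∀ {ε : ℝ}, 0 ≤ ε → Monotone (gronwallBound ε (L.toNNReal : ℝ) ε) := fun h =>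
    gronwallBound_mono h h (NNReal.coe_nonneg _)
  have hB0 : 0 ≤ B := by
    have := hmono zero_le_one hT.le
    rw [gronwallBound_x0] at this
    linarith
  -- The Grönwall bound is homogeneous in ε, so the total error is ε for y against w plus ε B for w
  -- against the flow, which add up to e.
  set ε : ℝ := e / (1 + B) with hε
  have hε0 : 0 < ε := by positivity
  have hyw' : ∀ᶠ t in atTop, ‖y t - w t‖ ≤ ε := by
    filter_upwards [(tendsto_zero_iff_norm_tendsto_zero.1 hyw).eventually (gt_mem_nhds hε0)] with t ht
      using ht.le
  obtain ⟨t₀, ht₀⟩ := eventually_atTop.1 (hc.and (hyw'.and (hw ε hε0)))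
  choose h1 h2 w' h3 h4 using ht₀
  filter_upwards [eventually_ge_atTop t₀] with t ht
  have hth : ∀ {h : ℝ}, 0 ≤ h → t₀ ≤ t + h := fun h => by linarith
  have hfinal : ∀ h ∈ Icc 0 T, ‖y (t + h) - Φ h (y t)‖ ≤ e := by
    intro h hh
    have hgr := dist_le_of_approx_trajectories_ODE (v := fun _ x => -gradient f x)
      (K := L.toNNReal) (f := fun h => w (t + h)) (g := fun h => Φ h (y t))
      (f' := fun h => if hh : 0 ≤ h then w' (t + h) (hth hh) else 0)
      (g' := fun h => -gradient f (Φ h (y t))) (a := 0) (b := T) (εf := ε) (εg := 0) (δ := ε)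
      (fun _ => hf.lipschitzWith_neg_gradient)
      (fun r hr => ContinuousAt.continuousWithinAt
        (ContinuousAt.comp (f := fun h => t + h) (h1 (t + r) (hth hr.1)) (by fun_prop)))
      (fun r hr => by
        have hd : HasDerivWithinAt (fun h : ℝ => t + h) 1 (Ici r) r :=
          ((hasDerivAt_id r).const_add t).hasDerivWithinAt
        have := (h3 (t + r) (hth hr.1)).scomp r hd (fun s hs => by
          simp only [mem_Ici] at hs ⊢; linarith)
        simpa [dif_pos hr.1, Function.comp_def] using this)
      (fun r hr => by
        rw [dif_pos hr.1, dist_eq_norm, sub_neg_eq_add]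
        exact h4 (t + r) (hth hr.1))
      (fun r hr => ((hΦ.hasDeriv (y t) r hr.1).continuousWithinAt).mono Icc_subset_Ici_self)
      (fun r hr => (hΦ.hasDeriv (y t) r hr.1).mono (Ici_subset_Ici.2 hr.1))
      (fun r hr => (dist_self _).le)
      (by
        rw [hΦ.map_zero, add_zero, dist_comm, dist_eq_norm]
        exact h2 t ht) h hh
    rw [sub_zero, add_zero] at hgr
    have h5 := hmono hε0.le hh.2
    rw [gronwallBound_self _ ε T, ← hB] at h5
    have h6 := h2 (t + h) (hth hh.1)
    calc ‖y (t + h) - Φ h (y t)‖ ≤ ‖y (t + h) - w (t + h)‖ + ‖w (t + h) - Φ h (y t)‖ :=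
          norm_sub_le_norm_sub_add_norm_sub _ _ _
      _ ≤ ε + ε * B := by
          rw [dist_eq_norm] at hgr
          linarith
      _ = e := by rw [hε]; field_simp
  refine (iSup₂_le fun h hh => ?_ : _ ≤ (e : ℝ≥0∞)).trans heη.le
  rw [← ofReal_norm]
  exact (ENNReal.ofReal_le_ofReal (hfinal h hh)).trans_eq (ENNReal.ofReal_coe_nnreal)

theorem interpolation_sub (γ : ℕ → ℝ) (x y : ℕ → Pt d) (t : ℝ) :
    interpolation γ x t - interpolation γ y t = interpolation γ (fun n => x n - y n) t := by
  simp only [interpolation]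
  module

theorem elapsed_succ_sub (γ : ℕ → ℝ) (n : ℕ) : elapsed γ (n + 1) - elapsed γ n = γ (n + 1) := by
  unfold elapsed
  rw [Finset.sum_range_succ _ (n + 1)]
  ring

variable {γ : ℕ → ℝ} (hγ : ∀ n, 0 < γ n)

include hγ in
theorem hasDerivWithinAt_interpolation (x : ℕ → Pt d) {n : ℕ} {t : ℝ}
    (ht : t ∈ Ico (elapsed γ n) (elapsed γ (n + 1))) :
    HasDerivWithinAt (interpolation γ x) ((γ (n + 1))⁻¹ • (x (n + 1) - x n)) (Ici t) t := by
  have h1 : HasDerivAt (fun s => x n +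
      ((s - elapsed γ n) / (elapsed γ (n + 1) - elapsed γ n)) • (x (n + 1) - x n))
      ((γ (n + 1))⁻¹ • (x (n + 1) - x n)) t := by
    rw [elapsed_succ_sub, ← one_div]
    exact ((((hasDerivAt_id t).sub_const _).div_const _).smul_const _).const_add _
  refine h1.hasDerivWithinAt.congr_of_eventuallyEq ?_ (interpolation_eq hγ x n ⟨ht.1, ht.2.le⟩)
  filter_upwards [Icc_mem_nhdsGE ht.2] with s hs
  exact interpolation_eq hγ x n ⟨ht.1.trans hs.1, hs.2⟩

variable (hγ_sum : Tendsto (fun N : ℕ => ∑ n ∈ Finset.range N, γ n) atTop atTop)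

include hγ hγ_sum in
theorem exists_mem_Ico_elapsed {M : ℕ} {t : ℝ} (ht : elapsed γ M ≤ t) :
    ∃ n, M ≤ n ∧ t ∈ Ico (elapsed γ n) (elapsed γ (n + 1)) := by
  have hm := elapsed_strictMono hγ
  have hex : ∃ n, t < elapsed γ n :=
    (((tendsto_add_atTop_iff_nat 1).2 hγ_sum).eventually_gt_atTop t).exists
  classical
  obtain ⟨n, hn⟩ : ∃ n, Nat.find hex = n + 1 := by
    refine Nat.exists_eq_succ_of_ne_zero fun h0 => ?_
    have := Nat.find_spec hex
    rw [h0] at this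
    exact absurd (hm.monotone (Nat.zero_le M)) (by linarith)
  have h1 : t < elapsed γ (n + 1) := hn ▸ Nat.find_spec hex
  have h2 : elapsed γ n ≤ t := not_lt.1 (Nat.find_min hex (by omega))
  exact ⟨n, Nat.lt_succ_iff.1 (hm.lt_iff_lt.1 (ht.trans_lt h1)), h2, h1⟩

include hγ hγ_sum in
-- At a node the left and right limits come from two different affine pieces; t must exceed the
-- first node for a left piece to exist.
theorem continuousAt_interpolation (x : ℕ → Pt d) {t : ℝ} (ht : elapsed γ 0 < t) :
    ContinuousAt (interpolation γ x) t := by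
  obtain ⟨n, -, hn⟩ := exists_mem_Ico_elapsed hγ hγ_sum ht.le
  have hleft : ∃ m, t ∈ Ioc (elapsed γ m) (elapsed γ (m + 1)) := by
    rcases eq_or_lt_of_le hn.1 with h | h
    · cases n with
      | zero => exact absurd h ht.ne
      | succ m => exact ⟨m, h ▸ elapsed_strictMono hγ m.lt_succ_self, h.ge⟩
    · exact ⟨n, h, hn.2.le⟩
  obtain ⟨m, hm⟩ := hleft
  refine continuousAt_iff_continuous_left_right.2
    ⟨?_, (hasDerivWithinAt_interpolation hγ x hn).continuousWithinAt⟩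
  have h1 : Continuous fun s => x m +
      ((s - elapsed γ m) / (elapsed γ (m + 1) - elapsed γ m)) • (x (m + 1) - x m) := by fun_prop
  refine h1.continuousWithinAt.congr_of_eventuallyEq ?_ (interpolation_eq hγ x m ⟨hm.1.le, hm.2⟩)
  filter_upwards [Icc_mem_nhdsLE hm.1] with s hs
  exact interpolation_eq hγ x m ⟨hs.1, hs.2.trans hm.2⟩

include hγ in
theorem interpolation_eq_lineMap (x : ℕ → Pt d) {n : ℕ} {t : ℝ}
    (ht : t ∈ Icc (elapsed γ n) (elapsed γ (n + 1))) :
    ∃ θ ∈ Icc (0 : ℝ) 1, interpolation γ x t = x n + θ • (x (n + 1) - x n) := by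
  have h := sub_nonneg.2 (ht.1.trans ht.2)
  exact ⟨_, ⟨div_nonneg (sub_nonneg.2 ht.1) h, div_le_one_of_le₀ (by linarith [ht.2]) h⟩,
    interpolation_eq hγ x n ht⟩

include hγ hγ_sum in
theorem tendsto_interpolation_zero {x : ℕ → Pt d} (hx : Tendsto x atTop (𝓝 0)) :
    Tendsto (interpolation γ x) atTop (𝓝 0) := by
  rw [Metric.tendsto_atTop] at hx ⊢
  intro ε hε
  obtain ⟨M, hM⟩ := hx ε hε
  refine ⟨elapsed γ M, fun t ht => ?_⟩
  obtain ⟨n, hn, htn⟩ := exists_mem_Ico_elapsed hγ hγ_sum ht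
  obtain ⟨θ, hθ, h⟩ := interpolation_eq_lineMap hγ x ⟨htn.1, htn.2.le⟩
  rw [h]
  exact (convex_ball (0 : Pt d) ε).add_smul_sub_mem (hM n hn) (hM (n + 1) (by omega)) hθ

include hγ hγ_sum in
/-- If `x` is asymptotic to the iterates `w` of a perturbed gradient descent with vanishing
perturbations, then its interpolation is an asymptotic pseudotrajectory of the gradient flow. -/
theorem isAPT_interpolation {f : Pt d → ℝ} {G L : ℝ} (hf : LipschitzSmooth f G L)
    {Φ : ℝ → Pt d → Pt d} (hΦ : IsGradientFlow f Φ) (hγ0 : Tendsto γ atTop (𝓝 0))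
    {x w r : ℕ → Pt d} (hw : ∀ n, w (n + 1) = w n - γ n • (gradient f (w n) + r n))
    (hr : Tendsto r atTop (𝓝 0)) (hxw : Tendsto (fun n => x n - w n) atTop (𝓝 0)) :
    IsAPT Φ (interpolation γ x) := by
  have hinc : Tendsto (fun n => w (n + 1) - w n) atTop (𝓝 0) := by
    rw [tendsto_zero_iff_norm_tendsto_zero]
    have h1 := hγ0.mul ((tendsto_zero_iff_norm_tendsto_zero.1 hr).const_add G)
    rw [zero_mul] at h1
    refine squeeze_zero (fun _ => norm_nonneg _) (fun n => ?_) h1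
    rw [hw, sub_sub_cancel_left, norm_neg, norm_smul, Real.norm_of_nonneg (hγ n).le]
    have := (hγ n).le
    gcongr
    exact (norm_add_le _ _).trans (by gcongr; exact hf.norm_gradient_le _)
  -- The interval from node n to node n + 1 has length γ (n + 1), whereas the increment from w n to
  -- w (n + 1) carries γ n. Shifting w by one index matches the two, so the slope is exactly -(∇f +
  -- r) at index n + 1; the shift is harmless because increments of w vanish.
  refine isAPT_of_approx_solution hf hΦ (w := interpolation γ fun n => w (n + 1)) ?_ ?_ ?_
  · filter_upwards [eventually_gt_atTop (elapsed γ 0)] with t ht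
    exact continuousAt_interpolation hγ hγ_sum _ ht
  · simp_rw [interpolation_sub]
    refine tendsto_interpolation_zero hγ hγ_sum ?_
    have := hxw.sub hinc
    rw [sub_zero] at this
    exact this.congr fun n => by abel
  · intro ε hε
    have herr : Tendsto (fun n => ‖r (n + 1)‖ + |L| * ‖w (n + 1 + 1) - w (n + 1)‖) atTop (𝓝 0) := by
      have := ((tendsto_zero_iff_norm_tendsto_zero.1 hr).add
        ((tendsto_zero_iff_norm_tendsto_zero.1 hinc).const_mul |L|))
      rw [mul_zero, add_zero] at this
      exact (tendsto_add_atTop_iff_nat 1).2 this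
    obtain ⟨M, hM⟩ := eventually_atTop.1 (herr.eventually (gt_mem_nhds hε))
    filter_upwards [eventually_ge_atTop (elapsed γ M)] with t ht
    obtain ⟨n, hn, htn⟩ := exists_mem_Ico_elapsed hγ hγ_sum ht
    refine ⟨_, hasDerivWithinAt_interpolation hγ _ htn, le_trans ?_ (hM n hn).le⟩
    obtain ⟨θ, hθ, h⟩ := interpolation_eq_lineMap hγ (fun n => w (n + 1)) ⟨htn.1, htn.2.le⟩
    have h1 : (γ (n + 1))⁻¹ • (w (n + 1 + 1) - w (n + 1)) =
        -(gradient f (w (n + 1)) + r (n + 1)) := by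
      rw [hw (n + 1), sub_sub_cancel_left, smul_neg, inv_smul_smul₀ (hγ _).ne']
    have h2 : ‖interpolation γ (fun n => w (n + 1)) t - w (n + 1)‖ ≤
        ‖w (n + 1 + 1) - w (n + 1)‖ := by
      rw [h, add_sub_cancel_left, norm_smul, Real.norm_of_nonneg hθ.1]
      exact mul_le_of_le_one_left (norm_nonneg _) hθ.2
    have h3 := hf.norm_gradient_sub_le (w (n + 1)) (interpolation γ (fun n => w (n + 1)) t)
    calc ‖(γ (n + 1))⁻¹ • (w (n + 1 + 1) - w (n + 1)) +
          gradient f (interpolation γ (fun n => w (n + 1)) t)‖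
        = ‖-r (n + 1) + (gradient f (interpolation γ (fun n => w (n + 1)) t) -
          gradient f (w (n + 1)))‖ := by rw [h1]; congr 1; abel
      _ ≤ ‖r (n + 1)‖ + ‖gradient f (interpolation γ (fun n => w (n + 1)) t) -
          gradient f (w (n + 1))‖ := (norm_add_le _ _).trans_eq (by rw [norm_neg])
      _ ≤ _ := by
          gcongr
          refine h3.trans ?_
          gcongr
          exact le_abs_self L

end Deterministic

/-! ### Global existence of the gradient flow. -/

section Flow

/-- A bounded Lipschitz vector field has a solution on `[0, ∞)` from every initial point. -/
theorem exists_solution_of_bounded_lipschitz {E : Type*} [NormedAddCommGroup E] [NormedSpace ℝ E]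
    [CompleteSpace E] {v : E → E} {K B : NNReal} (hv : LipschitzWith K v) (hB : ∀ x, ‖v x‖ ≤ B)
    (x : E) : ∃ y : ℝ → E, y 0 = x ∧
      ∀ t ∈ Ici (0 : ℝ), HasDerivWithinAt y (v (y t)) (Ici 0) t := by
  have hloc : ∀ n : ℕ, ∃ y : ℝ → E, y 0 = x ∧
      ∀ t ∈ Icc (0 : ℝ) n, HasDerivWithinAt y (v (y t)) (Icc 0 n) t := by
    intro n
    -- With speed at most B, a ball of radius B n cannot be left during [0, n], so no smallness of
    -- the time interval is needed.
    have hpl : IsPicardLindelof (fun _ => v) (⟨0, le_rfl, n.cast_nonneg⟩ : Icc (0 : ℝ) n) x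
        (B * n) 0 B K :=
      { lipschitzOnWith := fun _ _ => hv.lipschitzOnWith
        continuousOn := fun _ _ => continuousOn_const
        norm_le := fun _ _ y _ => hB y
        mul_max_le := by simp }
    exact hpl.exists_eq_forall_mem_Icc_hasDerivWithinAt₀
  choose y hy0 hy using hloc
  have hagree : ∀ m n : ℕ, m ≤ n → EqOn (y m) (y n) (Icc 0 m) := by
    intro m n hmn t ht
    have hmn' : (m : ℝ) ≤ n := by exact_mod_cast hmn
    have hright : ∀ k : ℕ, ∀ r ∈ Ico (0 : ℝ) k, HasDerivWithinAt (y k) (v (y k r)) (Ici r) r :=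
      fun k r hr => (hy k r ⟨hr.1, hr.2.le⟩).mono_of_mem_nhdsWithin
        (mem_of_superset (Icc_mem_nhdsGE hr.2) (Icc_subset_Icc_left hr.1))
    have := dist_le_of_trajectories_ODE (v := fun _ => v) (K := K) (a := 0) (b := m) (δ := 0)
      (f := y m) (g := y n) (fun _ => hv)
      (fun r hr => (hy m r hr).continuousWithinAt) (hright m)
      (fun r hr => ((hy n r ⟨hr.1, hr.2.trans hmn'⟩).continuousWithinAt).mono
        (Icc_subset_Icc_right hmn'))
      (fun r hr => hright n r ⟨hr.1, hr.2.trans_le hmn'⟩)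
      (by rw [hy0, hy0, dist_self]) t ht
    rw [zero_mul] at this
    exact dist_le_zero.1 this
  have heq : ∀ n : ℕ, ∀ t ∈ Icc (0 : ℝ) n, y ⌈t⌉₊ t = y n t := fun n t ht =>
    hagree _ _ (Nat.ceil_le.2 ht.2) ⟨ht.1, Nat.le_ceil t⟩
  -- The local solutions agree by uniqueness, so choosing the one on [0, ⌈t⌉] at each t glues them.
  refine ⟨fun t => y ⌈t⌉₊ t, by simp [hy0], fun t ht => ?_⟩
  obtain ⟨n, hn⟩ := exists_nat_gt t
  have ht' : t ∈ Icc (0 : ℝ) n := ⟨ht, hn.le⟩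
  have h1 : HasDerivWithinAt (fun t => y ⌈t⌉₊ t) (v (y n t)) (Icc 0 n) t :=
    (hy n t ht').congr (heq n) (heq n t ht')
  rw [← heq n t ht'] at h1
  refine h1.mono_of_mem_nhdsWithin ?_
  rw [← Ici_inter_Iic, inter_comm]
  exact inter_mem (mem_nhdsWithin_of_mem_nhds (Iic_mem_nhds hn)) self_mem_nhdsWithin

theorem LipschitzSmooth.exists_isGradientFlow {d : ℕ} {f : Pt d → ℝ} {G L : ℝ}
    (hf : LipschitzSmooth f G L) : ∃ Φ : ℝ → Pt d → Pt d, IsGradientFlow f Φ := by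
  choose y hy0 hy using exists_solution_of_bounded_lipschitz hf.lipschitzWith_neg_gradient
    (B := G.toNNReal) fun x => by
      rw [norm_neg]
      exact (hf.norm_gradient_le x).trans (Real.le_coe_toNNReal G)
  exact ⟨fun t x => y x t, hy0, hy⟩

end Flow

/-! ### Moments and conditional mean of the oracle noise along the iterates. -/

section Noise

variable {d : ℕ} {S : Type*} [MeasurableSpace S] {P : Measure S} {Z : Pt d → S → Pt d} {q σ : ℝ}

variable {Ω : Type*} {m m0 : MeasurableSpace Ω} {μ : Measure Ω} [IsProbabilityMeasure μ]

theorem map_prodMk_of_indep (hm : m ≤ m0) {β : Type*} [MeasurableSpace β]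
    {Y : Ω → β} (hY : Measurable[m] Y) {s : Ω → S} (hs : Measurable s) (hlaw : μ.map s = P)
    (hind : Indep m (MeasurableSpace.comap s inferInstance) μ) :
    μ.map (fun ω => (Y ω, s ω)) = (μ.map Y).prod P := by
  have h1 : IndepFun Y s μ := indep_of_indep_of_le_left hind hY.comap_le
  rw [(indepFun_iff_map_prod_eq_prod_map_map (hY.mono hm le_rfl).aemeasurable
    hs.aemeasurable).1 h1, hlaw]

variable [IsProbabilityMeasure P]

theorem OracleNoise.lintegral_le (hZ : OracleNoise Z P q σ) (hm : m ≤ m0)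
    {Y : Ω → Pt d} (hY : Measurable[m] Y) {s : Ω → S} (hs : Measurable s) (hlaw : μ.map s = P)
    (hind : Indep m (MeasurableSpace.comap s inferInstance) μ) :
    ∫⁻ ω, ‖Z (Y ω) (s ω)‖ₑ ^ q ∂μ ≤ ENNReal.ofReal (σ ^ q) := by
  have hY' := hY.mono hm le_rfl
  have hprob := Measure.isProbabilityMeasure_map (μ := μ) hY'.aemeasurable
  have hmeas : Measurable fun p : Pt d × S => ‖Z p.1 p.2‖ₑ ^ q :=
    hZ.measurable.enorm.pow_const q
  calc ∫⁻ ω, ‖Z (Y ω) (s ω)‖ₑ ^ q ∂μ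
      = ∫⁻ p, ‖Z p.1 p.2‖ₑ ^ q ∂(μ.map fun ω => (Y ω, s ω)) :=
        (lintegral_map hmeas (hY'.prodMk hs)).symm
    _ = ∫⁻ x, ∫⁻ s, ‖Z x s‖ₑ ^ q ∂P ∂(μ.map Y) := by
        rw [map_prodMk_of_indep hm hY hs hlaw hind, lintegral_prod _ hmeas.aemeasurable]
    _ ≤ ∫⁻ _, ENNReal.ofReal (σ ^ q) ∂(μ.map Y) := lintegral_mono hZ.moment_le
    _ = ENNReal.ofReal (σ ^ q) := by simp

theorem OracleNoise.memLp (hZ : OracleNoise Z P q σ) (hq : 2 ≤ q)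
    (hm : m ≤ m0)
    {Y : Ω → Pt d} (hY : Measurable[m] Y) {s : Ω → S} (hs : Measurable s) (hlaw : μ.map s = P)
    (hind : Indep m (MeasurableSpace.comap s inferInstance) μ) :
    MemLp (fun ω => Z (Y ω) (s ω)) (ENNReal.ofReal q) μ := by
  have hmeas : Measurable fun ω => Z (Y ω) (s ω) :=
    hZ.measurable.comp ((hY.mono hm le_rfl).prodMk hs)
  refine ⟨hmeas.aestronglyMeasurable, ?_⟩
  rw [eLpNorm_lt_top_iff_lintegral_rpow_enorm_lt_top (by simp; linarith) (by simp),
    ENNReal.toReal_ofReal (by linarith)]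
  exact (hZ.lintegral_le hm hY hs hlaw hind).trans_lt ENNReal.ofReal_lt_top

theorem OracleNoise.integral_le (hZ : OracleNoise Z P q σ) (hq : 2 ≤ q) (hσ : 0 ≤ σ)
    (hm : m ≤ m0)
    {Y : Ω → Pt d} (hY : Measurable[m] Y) {s : Ω → S} (hs : Measurable s) (hlaw : μ.map s = P)
    (hind : Indep m (MeasurableSpace.comap s inferInstance) μ) :
    ∫ ω, ‖Z (Y ω) (s ω)‖ ^ q ∂μ ≤ σ ^ q := by
  have hmem := hZ.memLp hq hm hY hs hlaw hind
  rw [integral_eq_lintegral_of_nonneg_ae (ae_of_all _ fun ω => by positivity)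
    (integrable_norm_rpow_of_memLp (by linarith) hmem).aestronglyMeasurable]
  refine ENNReal.toReal_le_of_le_ofReal (by positivity) ?_
  refine le_trans (le_of_eq ?_) (hZ.lintegral_le hm hY hs hlaw hind)
  refine lintegral_congr fun ω => ?_
  rw [← ofReal_norm, ENNReal.ofReal_rpow_of_nonneg (norm_nonneg _) (by linarith)]

theorem OracleNoise.condExp_eq_zero (hZ : OracleNoise Z P q σ) (hq : 2 ≤ q)
    (hm : m ≤ m0)
    {Y : Ω → Pt d} (hY : Measurable[m] Y) {s : Ω → S} (hs : Measurable s) (hlaw : μ.map s = P)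
    (hind : Indep m (MeasurableSpace.comap s inferInstance) μ) :
    μ[fun ω => Z (Y ω) (s ω) | m] =ᵐ[μ] 0 := by
  have hint : Integrable (fun ω => Z (Y ω) (s ω)) μ :=
    (hZ.memLp hq hm hY hs hlaw hind).integrable (by
      rw [← ENNReal.ofReal_one]
      exact ENNReal.ofReal_le_ofReal (by linarith))
  symm
  refine ae_eq_condExp_of_forall_setIntegral_eq hm hint (fun _ _ _ => integrableOn_zero)
    (fun A hA _ => ?_) aestronglyMeasurable_zero
  simp only [Pi.zero_apply, integral_zero]
  -- Bundling the indicator of A with Y gives a single `m`-measurable variable, independent of the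
  -- seed; Fubini then integrates out the seed first, where the mean is zero.
  have hYA : Measurable[m] fun ω => (Y ω, A.indicator (fun _ => (1 : ℝ)) ω) :=
    hY.prodMk (measurable_const.indicator hA)
  have hmeas : Measurable fun p : (Pt d × ℝ) × S => p.1.2 • Z p.1.1 p.2 :=
    measurable_fst.snd.smul (hZ.measurable.comp (measurable_fst.fst.prodMk measurable_snd))
  have hmap := map_prodMk_of_indep hm hYA hs hlaw hind
  have hpair : Measurable fun ω => ((Y ω, A.indicator (fun _ => (1 : ℝ)) ω), s ω) :=
    (hYA.mono hm le_rfl).prodMk hs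
  have hind' : ∀ ω, A.indicator (fun ω => Z (Y ω) (s ω)) ω =
      A.indicator (fun _ => (1 : ℝ)) ω • Z (Y ω) (s ω) := fun ω => by
    by_cases h : ω ∈ A <;> simp [h]
  have hint' : Integrable (fun p : (Pt d × ℝ) × S => p.1.2 • Z p.1.1 p.2)
      ((μ.map fun ω => (Y ω, A.indicator (fun _ => (1 : ℝ)) ω)).prod P) := by
    rw [← hmap, integrable_map_measure hmeas.aestronglyMeasurable hpair.aemeasurable]
    exact (hint.indicator (hm _ hA)).congr (ae_of_all _ hind')
  have hprob := Measure.isProbabilityMeasure_map (μ := μ) (hYA.mono hm le_rfl).aemeasurable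
  symm
  calc ∫ ω in A, Z (Y ω) (s ω) ∂μ
      = ∫ ω, A.indicator (fun _ => (1 : ℝ)) ω • Z (Y ω) (s ω) ∂μ := by
        rw [← integral_indicator (hm _ hA)]
        exact integral_congr_ae (ae_of_all _ hind')
    _ = ∫ p : (Pt d × ℝ) × S, p.1.2 • Z p.1.1 p.2
          ∂(μ.map fun ω => ((Y ω, A.indicator (fun _ => (1 : ℝ)) ω), s ω)) :=
        (integral_map hpair.aemeasurable hmeas.aestronglyMeasurable).symm
    _ = 0 := by
        rw [hmap, integral_prod _ hint']
        simp only [integral_smul, hZ.zero_mean, smul_zero, integral_zero]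

/-- The running average of the oracle noise along an adapted sequence of query points tends to
zero almost surely. -/
theorem OracleNoise.ae_tendsto_runningAverage (hZ : OracleNoise Z P q σ) (hq : 2 ≤ q) (hσ : 0 ≤ σ)
    {ℱ : Filtration ℕ m0} {X : ℕ → Ω → Pt d} (hX : ∀ n, Measurable[ℱ n] (X n)) {s : ℕ → Ω → S}
    (hZX : ∀ n, Measurable[ℱ (n + 1)] fun ω => Z (X n ω) (s n ω))
    (hs : ∀ n, Measurable (s n)) (hlaw : ∀ n, μ.map (s n) = P)
    (hind : ∀ n, Indep (ℱ n) (MeasurableSpace.comap (s n) inferInstance) μ)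
    {γ : ℕ → ℝ} {b : ℝ} (hb0 : 0 < b) (hγ : ∀ n, 0 ≤ γ n) (hγb : ∀ n, γ n ≤ b)
    (hγ_sum : Tendsto (fun N : ℕ => ∑ n ∈ Finset.range N, γ n) atTop atTop)
    (hγ_pow : Summable fun n : ℕ => γ n ^ (1 + q / 2)) :
    ∀ᵐ ω ∂μ, Tendsto (runningAverage (fun n => b⁻¹ * γ n) fun n => b • Z (X n ω) (s n ω))
      atTop (𝓝 0) := by
  -- Dividing the weights by b puts them in [0, 1], and multiplying the noise by b keeps each
  -- contribution equal to γ n times the noise.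
  refine SGD.ae_tendsto_runningAverage (ℱ := ℱ) (U := fun n ω => b • Z (X n ω) (s n ω))
    (C := b ^ q * σ ^ q) hq (fun n => ((hZX n).const_smul b).stronglyMeasurable)
    (fun n => (hZ.memLp hq (ℱ.le n) (hX n) (hs n) (hlaw n) (hind n)).const_smul b)
    (fun n => ?_) (fun n => ?_) (fun n => mul_nonneg (inv_nonneg.2 hb0.le) (hγ n))
    (fun n => ?_) ?_ ?_
  · have h1 := hZ.integral_le hq hσ (ℱ.le n) (hX n) (hs n) (hlaw n) (hind n)
    simp only [norm_smul, Real.norm_of_nonneg hb0.le, Real.mul_rpow hb0.le (norm_nonneg _)]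
    rw [integral_const_mul]
    gcongr
  · have h1 := hZ.condExp_eq_zero hq (ℱ.le n) (hX n) (hs n) (hlaw n) (hind n)
    filter_upwards [condExp_smul (μ := μ) b (fun ω => Z (X n ω) (s n ω)) (ℱ n), h1] with ω h2 h3
    refine h2.trans ?_
    rw [Pi.smul_apply, h3]
    simp
  · rw [inv_mul_le_iff₀ hb0, mul_one]
    exact hγb n
  · simp_rw [← Finset.mul_sum]
    exact hγ_sum.const_mul_atTop (inv_pos.2 hb0)
  · simp_rw [fun n => Real.mul_rpow (z := 1 + q / 2) (inv_nonneg.2 hb0.le) (hγ n)]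
    exact hγ_pow.mul_left _

end Noise

/-! ### Measurability of the iterates and conclusion. -/

theorem measurable_iterate {d : ℕ} {S : Type*} [MeasurableSpace S] {Ω : Type*} [MeasurableSpace Ω]
    {f : Pt d → ℝ} (hf : Continuous (gradient f)) {Z : Pt d → S → Pt d}
    (hZ : Measurable (Function.uncurry Z)) (γ : ℕ → ℝ) {X₀ : Ω → Pt d} (hX₀ : Measurable X₀)
    {s : ℕ → Ω → S} (hs : ∀ n, Measurable (s n)) (n : ℕ) :
    Measurable fun ω => iterate f Z γ (X₀ ω) (fun k => s k ω) n := by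
  induction n with
  | zero => exact hX₀
  | succ n ih =>
    exact ih.sub (((hf.measurable.comp ih).add (hZ.comp (ih.prodMk (hs n)))).const_smul (γ n))

end SGD

theorem mainTheorem5 {d : ℕ} (f : SGD.Pt d → ℝ) (G L : ℝ) (hf : SGD.LipschitzSmooth f G L)
    {S : Type*} [MeasurableSpace S] (P : Measure S) [IsProbabilityMeasure P]
    (Z : SGD.Pt d → S → SGD.Pt d) (q σ : ℝ) (hq : 2 ≤ q) (hσ : 0 ≤ σ)
    (hZ : SGD.OracleNoise Z P q σ)
    (γ : ℕ → ℝ) (hγ : ∀ n, 0 < γ n)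
    (hγ_sum : Tendsto (fun N : ℕ => ∑ n ∈ Finset.range N, γ n) atTop atTop)
    (hγ_pow : Summable (fun n : ℕ => γ n ^ (1 + q / 2)))
    {Ω : Type*} [MeasurableSpace Ω] (μ : Measure Ω) [IsProbabilityMeasure μ]
    (X₀ : Ω → SGD.Pt d) (hX₀ : Measurable X₀)
    (s : ℕ → Ω → S) (hs : ∀ n, Measurable (s n)) (hs_law : ∀ n, μ.map (s n) = P)
    (X : ℕ → Ω → SGD.Pt d)
    (hX : ∀ n ω, X n ω = SGD.iterate f Z γ (X₀ ω) (fun k => s k ω) n)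
    (hs_indep : ∀ n, Indep (⨆ k ∈ Finset.range (n + 1), MeasurableSpace.comap (X k) inferInstance)
      (MeasurableSpace.comap (s n) inferInstance) μ) :
    (∃ Φ : ℝ → SGD.Pt d → SGD.Pt d, SGD.IsGradientFlow f Φ) ∧
      ∀ Φ : ℝ → SGD.Pt d → SGD.Pt d, SGD.IsGradientFlow f Φ →
        ∀ᵐ ω ∂μ, SGD.IsAPT Φ (SGD.interpolation γ (fun n => X n ω)) := by
  refine ⟨hf.exists_isGradientFlow, fun Φ hΦ => ?_⟩
  have hcont := hf.continuous_gradient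
  have hXm : ∀ n, Measurable (X n) := fun n => by
    rw [show X n = _ from funext (hX n)]
    exact SGD.measurable_iterate hcont hZ.measurable γ hX₀ hs n
  have hXs : ∀ n ω, X (n + 1) ω =
      X n ω - γ n • (gradient f (X n ω) + Z (X n ω) (s n ω)) := fun n ω => by
    rw [hX, hX]
    rfl
  let ℱ : Filtration ℕ ‹MeasurableSpace Ω› :=
    { seq := fun n => ⨆ k ∈ Finset.range (n + 1), MeasurableSpace.comap (X k) inferInstance
      mono' := fun m n hmn => biSup_mono fun k hk =>
        Finset.range_mono (Nat.succ_le_succ hmn) hk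
      le' := fun n => iSup₂_le fun k _ => (hXm k).comap_le }
  have hXℱ : ∀ {k n : ℕ}, k ≤ n → Measurable[ℱ n] (X k) := fun {k n} hk =>
    measurable_iff_comap_le.2 (le_iSup₂_of_le k (Finset.mem_range.2 (Nat.lt_succ_of_le hk)) le_rfl)
  have hγ0 : Tendsto γ atTop (𝓝 0) := by
    have h1 := hγ_pow.tendsto_atTop_zero.rpow_const (p := 1 / (1 + q / 2))
      (Or.inr (by positivity))
    rw [Real.zero_rpow (by positivity)] at h1
    refine h1.congr fun n => ?_
    rw [← Real.rpow_mul (hγ n).le, mul_one_div_cancel (by positivity), Real.rpow_one]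
  obtain ⟨b, hb⟩ := hγ0.bddAbove_range
  have hb0 : 0 < b := (hγ 0).trans_le (hb (mem_range_self 0))
  -- The filtration is generated by the iterates, not by the seeds; the noise is still adapted
  -- because the recursion, with γ n > 0, recovers it from two consecutive iterates.
  have hZℱ : ∀ n, Measurable[ℱ (n + 1)] fun ω => Z (X n ω) (s n ω) := fun n => by
    have h1 : (fun ω => Z (X n ω) (s n ω)) = fun ω =>
        (γ n)⁻¹ • (X n ω - X (n + 1) ω) - gradient f (X n ω) := by
      funext ω
      rw [hXs, sub_sub_cancel, inv_smul_smul₀ (hγ n).ne', add_sub_cancel_left]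
    rw [h1]
    have h2 := hXℱ n.le_succ
    have h3 := (h2.sub (hXℱ le_rfl)).const_smul (γ n)⁻¹
    exact h3.sub (hcont.measurable.comp h2)
  have hae := hZ.ae_tendsto_runningAverage hq hσ (fun n => hXℱ le_rfl) hZℱ hs hs_law hs_indep
    hb0 (fun n => (hγ n).le) (fun n => hb (mem_range_self n)) hγ_sum hγ_pow
  filter_upwards [hae] with ω hω
  set N : ℕ → SGD.Pt d :=
    SGD.runningAverage (fun n => b⁻¹ * γ n) fun n => b • Z (X n ω) (s n ω) with hN
  have hNs : ∀ n, N (n + 1) = (1 - b⁻¹ * γ n) • N n + γ n • Z (X n ω) (s n ω) := fun n => by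
    have h1 : N (n + 1) =
      (1 - b⁻¹ * γ n) • N n + (b⁻¹ * γ n) • b • Z (X n ω) (s n ω) := rfl
    rw [h1, smul_smul, mul_right_comm, inv_mul_cancel₀ hb0.ne', one_mul]
  refine SGD.isAPT_interpolation hγ hγ_sum hf hΦ hγ0 (w := fun n => X n ω + N n)
    (r := fun n => b⁻¹ • N n - (gradient f (X n ω + N n) - gradient f (X n ω))) (fun n => ?_) ?_ ?_
  · rw [hXs, hNs]
    module
  · have h1 : Tendsto (fun n => gradient f (X n ω + N n) - gradient f (X n ω)) atTop (𝓝 0) := by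
      refine squeeze_zero_norm (a := fun n => L * ‖N n‖) (fun n => ?_) ?_
      · simpa using hf.norm_gradient_sub_le (X n ω) (X n ω + N n)
      · simpa using (tendsto_zero_iff_norm_tendsto_zero.1 hω).const_mul L
    simpa using (hω.const_smul b⁻¹).sub h1
  · simpa using hω.neg
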